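/- **Theorem (Generic flatness).** Let $f\colon X\to Y$ be a morphism of finite type between Noetherian schemes, with $Y$ reduced and non-empty, and let $\mathscr F$ be a coherent sheaf on $X$, i.e. an $\mathscr O_X$-module such that $X$ is covered by affine open subsets $V=\operatorname{Spec} B$ on each of which $\mathscr F|_V\cong\widetilde M$ for some finitely generated $B$-module $M$. Then there is a non-empty open subset $U\subseteq Y$ such that $\mathscr F|_{f^{-1}U}$ is flat over $U$; that is, for every $x\in f^{-1}U$ the stalk $\mathscr F_x$, regarded as a module over $\mathscr O_{Y,f(x)}$ through the ring homomorphism $\mathscr O_{Y,f(x)}\to\mathscr O_{X,x}$ induced by $f$, is a flat $\mathscr O_{Y,f(x)}$-module. -/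

import Mathlib

open CategoryTheory AlgebraicGeometry TopologicalSpace

universe u

namespace AlgebraicGeometry.Scheme.Modules

/-- The module structure of the stalk `F_x` over the local ring `𝒪_{X,x}`; it is the one with
`germ (r • m) = germ r • germ m`, see `germ_smul_stalk`. -/
noncomputable instance stalkModule {X : Scheme.{u}} (F : X.Modules) (x : X) :
    Module (X.presheaf.stalk x) ↑(TopCat.Presheaf.stalk F.presheaf x) :=
  letI P : _root_.PresheafOfModules.{u} (X.presheaf ⋙ forget₂ CommRingCat RingCat) := F.val
  inferInstanceAs (Module (X.presheaf.stalk x) ↑(TopCat.Presheaf.stalk P.presheaf x))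

lemma germ_smul_stalk {X : Scheme.{u}} (F : X.Modules) (x : X) (U : X.Opens) (hx : x ∈ U)
    (r : Γ(X, U)) (m : Γ(F, U)) :
    TopCat.Presheaf.germ F.presheaf U x hx (r • m) =
      X.presheaf.germ U x hx r • TopCat.Presheaf.germ F.presheaf U x hx m :=
  PresheafOfModules.germ_smul (R := X.presheaf) F.val x U hx r m

/-- A coherent sheaf: `X` is covered by affine opens `U = Spec A` on which `F` is isomorphic to
the sheaf `M^~` associated with a finitely generated `A`-module `M`. -/
def IsCoherent {X : Scheme.{u}} (F : X.Modules) : Prop :=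
  ∀ x : X, ∃ (U : X.Opens) (hU : IsAffineOpen U), x ∈ U ∧
    ∃ M : ModuleCat.{u} Γ(X, U), Module.Finite Γ(X, U) M ∧
      Nonempty (F.restrict hU.fromSpec ≅ tilde M)

/-- `F` is flat at `x` over `Y`: the stalk `F_x`, an `𝒪_{Y,f(x)}`-module through
`𝒪_{Y,f(x)} ⟶ 𝒪_{X,x}`, is flat. -/
def IsFlatAt {X Y : Scheme.{u}} (f : X ⟶ Y) (F : X.Modules) (x : X) : Prop :=
  letI : Module (Y.presheaf.stalk (f x)) ↑(TopCat.Presheaf.stalk F.presheaf x) :=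
    Module.compHom ↑(TopCat.Presheaf.stalk F.presheaf x) (f.stalkMap x).hom
  Module.Flat (Y.presheaf.stalk (f x)) ↑(TopCat.Presheaf.stalk F.presheaf x)

/-- `F` is flat over `Y`. -/
def IsFlatOver {X Y : Scheme.{u}} (f : X ⟶ Y) (F : X.Modules) : Prop :=
  ∀ x : X, IsFlatAt f F x

end AlgebraicGeometry.Scheme.Modules

/-!
At a minimal prime `p` of a reduced Noetherian ring `A` the local ring `A_p` is a field, so a finite
`A`-module becomes free after inverting some `a ∉ p`. This extends from `A` to `A[X₁, …, Xₙ]`, and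
hence to every `A`-algebra of finite type, by induction on `n`: a finite `B[X]`-module `M` generated
by a finite `B`-submodule `N` is the union of the `B`-submodules `N + X N + ⋯ + X^(k-1) N`. The
successive quotients are `N / K_k` for an increasing sequence of submodules `K_k` of `N`. As `N` is
Noetherian, only finitely many `K_k` occur, so a single `a ∉ p` makes all the quotients flat, and
with them all the finite sums and their union `M`.

For `f : X ⟶ Y`, the preimage of an affine open subset of `Y` is quasi-compact, so finitely many
affine pieces, hence a single `a`, suffice. Stalks of the sheaf are localizations of its modules of
sections, and flatness passes to them.
-/

namespace GenericFlatness

section Flat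

variable {A : Type*} [CommRing A] {M N Q : Type*} [AddCommGroup M] [Module A M]
  [AddCommGroup N] [Module A N] [AddCommGroup Q] [Module A Q]

lemma isTrivialRelation_map (φ : M →ₗ[A] N) {l : ℕ} {f : Fin l → A} {x : Fin l → M}
    (h : Module.IsTrivialRelation f x) :
    Module.IsTrivialRelation f fun i ↦ φ (x i) := by
  obtain ⟨k, a, y, hx, ha⟩ := h
  exact ⟨k, a, fun j ↦ φ (y j), fun i ↦ by simp [hx i], ha⟩

lemma flat_of_bijective_semilinearMap {R M' : Type*} [CommRing R] [AddCommGroup M'] [Module R M']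
    {σ : R →+* A} (hσ : Function.Surjective σ) (e : M' →ₛₗ[σ] M) (he : Function.Bijective e)
    [Module.Flat R M'] : Module.Flat A M := by
  refine Module.Flat.of_forall_isTrivialRelation fun {l f x} hfx ↦ ?_
  choose g hg using fun i ↦ hσ (f i)
  choose z hz using fun i ↦ he.surjective (x i)
  have hgz : ∑ i, g i • z i = 0 := he.injective (by simp [hg, hz, hfx])
  obtain ⟨k, a, y, hy, ha⟩ := Module.Flat.isTrivialRelation_of_sum_smul_eq_zero hgz
  refine ⟨k, fun i j ↦ σ (a i j), fun j ↦ e (y j), fun i ↦ ?_, fun j ↦ ?_⟩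
  · simpa [hz] using congr(e $(hy i))
  · simpa [hg] using congr(σ $(ha j))

lemma flat_of_exact {f : N →ₗ[A] M} {g : M →ₗ[A] Q} (hf : Function.Injective f)
    (hfg : Function.Exact f g) (hg : Function.Surjective g)
    [Module.Flat A N] [Module.Flat A Q] : Module.Flat A M := by
  refine Module.Flat.iff_rTensor_injective'.mpr fun I ↦ ?_
  have hIN : Function.Injective (I.subtype.rTensor N) :=
    Module.Flat.rTensor_preserves_injective_linearMap _ I.injective_subtype
  have hIQ : Function.Injective (I.subtype.rTensor Q) :=
    Module.Flat.rTensor_preserves_injective_linearMap _ I.injective_subtype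
  exact LinearMap.injective_of_surjective_of_injective_of_injective
    (0 : Unit →ₗ[A] _) (f.lTensor I) (g.lTensor I) 0 (f.lTensor A) (g.lTensor A)
    0 (I.subtype.rTensor N) (I.subtype.rTensor M) (I.subtype.rTensor Q)
    (by simp) (by simp) (by simp)
    ((LinearMap.exact_zero_iff_injective Unit (f.lTensor I)).mpr
      (LinearMap.lTensor_injective_of_exact_of_flat g hg f hf hfg I)) (lTensor_exact I hfg hg)
    ((LinearMap.exact_zero_iff_injective Unit (f.lTensor A)).mpr
      (Module.Flat.lTensor_preserves_injective_linearMap f hf))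
    (Function.surjective_to_subsingleton _) hIN hIQ

lemma flat_of_directed {ι : Type*} [Nonempty ι] {P : ι → Submodule A M}
    (hdir : Directed (· ≤ ·) P) (htop : ⨆ i, P i = ⊤) (hflat : ∀ i, Module.Flat A (P i)) :
    Module.Flat A M := by
  refine Module.Flat.of_forall_isTrivialRelation fun {l f x} hfx ↦ ?_
  have hmem (j : Fin l) : ∃ i, x j ∈ P i :=
    (Submodule.mem_iSup_of_directed P hdir).mp (htop ▸ Submodule.mem_top)
  choose k hk using hmem
  obtain ⟨i, hi⟩ := hdir.finite_le k
  have hsum : ∑ j, f j • (⟨x j, hi j (hk j)⟩ : P i) = 0 := Subtype.ext (by simpa using hfx)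
  exact isTrivialRelation_map (P i).subtype
    (Module.Flat.isTrivialRelation_of_sum_smul_eq_zero hsum)

end Flat

section Localization

variable {A B : Type*} [CommRing A] [CommRing B] [Algebra A B] {N N' : Type*}
  [AddCommGroup N] [Module A N] [Module B N] [IsScalarTower A B N]
  [AddCommGroup N'] [Module A N'] [Module B N'] [IsScalarTower A B N']

lemma exists_sum_smul_eq_zero_of_isLocalizedModule (S : Submonoid B) (φ : N →ₗ[B] N')
    [IsLocalizedModule S φ] {ι : Type*} [Fintype ι] {f : ι → A} {x : ι → N'}
    (hfx : ∑ i, f i • x i = 0) :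
    ∃ (s : S) (y : ι → N), (∀ i, φ (y i) = (s : B) • x i) ∧ ∑ i, f i • y i = 0 := by
  obtain ⟨b, hb⟩ := IsLocalizedModule.exist_integer_multiples_of_finite S φ x
  choose y hy using hb
  have hφ : φ (∑ i, f i • y i) = 0 := calc
    φ (∑ i, f i • y i) = ∑ i, f i • φ (y i) := map_sum (φ.restrictScalars A) _ _ |>.trans
      (Finset.sum_congr rfl fun i _ ↦ (φ.restrictScalars A).map_smul _ _)
    _ = (b : B) • ∑ i, f i • x i := by
      simp only [hy, Finset.smul_sum, smul_comm (b : B)]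
    _ = 0 := by rw [hfx, smul_zero]
  obtain ⟨c, hc⟩ := (IsLocalizedModule.eq_zero_iff S φ).mp hφ
  refine ⟨c * b, fun i ↦ (c : B) • y i, fun i ↦ ?_, ?_⟩
  · rw [map_smul, hy, smul_smul, Submonoid.coe_mul]
  · rw [← hc, Submonoid.smul_def, Finset.smul_sum]
    exact Finset.sum_congr rfl fun i _ ↦ smul_comm _ _ _

lemma flat_of_isLocalizedModule_of_comp_eq (S : Submonoid B) (φ : N →ₗ[B] N')
    [IsLocalizedModule S φ] {P : Type*} [AddCommGroup P] [Module A P] [Module.Flat A P]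
    {g : N →ₗ[A] P} {ψ : P →ₗ[A] N'} (hψg : ψ ∘ₗ g = φ.restrictScalars A) :
    Module.Flat A N' := by
  refine Module.Flat.of_forall_isTrivialRelation fun {l f x} hfx ↦ ?_
  obtain ⟨s, y, hy, hfy⟩ := exists_sum_smul_eq_zero_of_isLocalizedModule S φ hfx
  have hgy : ∑ i, f i • g (y i) = 0 := by simpa using congr(g $hfy)
  have hψ : Module.IsTrivialRelation f fun i ↦ ψ (g (y i)) :=
    isTrivialRelation_map ψ (Module.Flat.isTrivialRelation_of_sum_smul_eq_zero hgy)
  obtain ⟨u, hu⟩ := IsLocalizedModule.map_units φ s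
  convert isTrivialRelation_map (((↑u⁻¹ : Module.End B N')).restrictScalars A) hψ using 2 with i
  have hsx : ψ (g (y i)) = (u : Module.End B N') (x i) := by
    rw [← LinearMap.comp_apply, hψg, hu, LinearMap.restrictScalars_apply, hy,
      Module.algebraMap_end_apply]
  rw [hsx, LinearMap.restrictScalars_apply, ← Module.End.mul_apply, Units.inv_mul,
    Module.End.one_apply]

lemma flat_of_isLocalizedModule_of_away (S : Submonoid B) (φ : N →ₗ[B] N')
    [IsLocalizedModule S φ] {a : A} (ha : IsUnit (algebraMap A (Module.End A N') a))
    [Module.Flat A (LocalizedModule (.powers a) N)] : Module.Flat A N' := by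
  have hunit (t : Submonoid.powers a) : IsUnit (algebraMap A (Module.End A N') t) := by
    obtain ⟨_, n, rfl⟩ := t
    simpa using ha.pow n
  exact flat_of_isLocalizedModule_of_comp_eq S φ
    (LocalizedModule.lift_comp (.powers a) (φ.restrictScalars A) hunit)

lemma flat_of_isLocalizedModule_of_isBaseChange {C L M E : Type*} [CommRing C] [CommRing L]
    [Algebra A L] [Algebra B L] [Algebra C B] [Algebra C L] [IsScalarTower A B L]
    [IsScalarTower C B L] [AddCommGroup M] [Module C M] [AddCommGroup E] [Module A E]
    [Module B E] [Module C E] [Module L E] [IsScalarTower A L E] [IsScalarTower B L E]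
    [IsScalarTower C L E] [Module C N] [IsScalarTower C B N]
    (S : Submonoid C) (T : Submonoid B) [IsLocalization S L] [IsLocalization T L]
    (φ : M →ₗ[C] E) [IsLocalizedModule S φ] {j : M →ₗ[C] N} (hj : IsBaseChange B j)
    {a : A} (ha : IsUnit (algebraMap A L a))
    [Module.Flat A (LocalizedModule (.powers a) N)] : Module.Flat A E := by
  have : IsScalarTower A B E := .to₁₂₄ A B L E
  have : IsScalarTower C B E := .to₁₂₄ C B L E
  have hφ : IsBaseChange L φ := (isLocalizedModule_iff_isBaseChange S L φ).mp inferInstance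
  have hlift : IsBaseChange L (hj.lift φ) := .of_comp hj (by rwa [hj.lift_comp])
  have : IsLocalizedModule T (hj.lift φ) :=
    (isLocalizedModule_iff_isBaseChange T L _).mpr hlift
  have haE : IsUnit (algebraMap A (Module.End A E) a) := by
    rw [Module.End.isUnit_iff]
    convert (Module.End.isUnit_iff _).mp (ha.map (algebraMap L (Module.End L E))) using 1
    ext m
    simp
  exact flat_of_isLocalizedModule_of_away T (hj.lift φ) haE

end Localization

section LocalizedModule

variable {A : Type*} [CommRing A] (S : Submonoid A) {M N Q : Type*} [AddCommGroup M] [Module A M]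
  [AddCommGroup N] [Module A N] [AddCommGroup Q] [Module A Q]

lemma flat_localizedModule_powers_of_dvd {a b : A} (hab : a ∣ b)
    [Module.Flat A (LocalizedModule (.powers a) M)] :
    Module.Flat A (LocalizedModule (.powers b) M) := by
  let φ := LocalizedModule.mkLinearMap (.powers b) M
  have hb : IsUnit (algebraMap A (Module.End A (LocalizedModule (.powers b) M)) b) :=
    IsLocalizedModule.map_units φ ⟨b, Submonoid.mem_powers b⟩
  obtain ⟨c, rfl⟩ := hab
  rw [map_mul, ((Commute.all a c).map (algebraMap A _)).isUnit_mul_iff] at hb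
  exact flat_of_isLocalizedModule_of_away (.powers (a * c)) φ hb.1

lemma flat_localizedModule_of_linearEquiv (e : M ≃ₗ[A] N)
    [Module.Flat A (LocalizedModule S N)] : Module.Flat A (LocalizedModule S M) :=
  .of_linearEquiv (IsLocalizedModule.linearEquiv S (LocalizedModule.mkLinearMap S M)
    (LocalizedModule.mkLinearMap S N ∘ₗ e.toLinearMap))

lemma flat_localizedModule_of_exact {f : N →ₗ[A] M} {g : M →ₗ[A] Q}
    (hf : Function.Injective f) (hfg : Function.Exact f g) (hg : Function.Surjective g)
    [Module.Flat A (LocalizedModule S N)] [Module.Flat A (LocalizedModule S Q)] :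
    Module.Flat A (LocalizedModule S M) :=
  flat_of_exact (f := (LocalizedModule.map S f).restrictScalars A)
    (g := (LocalizedModule.map S g).restrictScalars A)
    (LocalizedModule.map_injective S f hf) (LocalizedModule.map_exact S f g hfg)
    (LocalizedModule.map_surjective S g hg)

lemma flat_localizedModule_of_directed {ι : Type*} [Nonempty ι] {P : ι → Submodule A M}
    (hdir : Directed (· ≤ ·) P) (htop : ⨆ i, P i = ⊤)
    (hflat : ∀ i, Module.Flat A (LocalizedModule S (P i))) :
    Module.Flat A (LocalizedModule S M) := by
  let φ := LocalizedModule.mkLinearMap S M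
  refine flat_of_directed (P := fun i ↦ (P i).localized₀ S φ) ?_ ?_ fun i ↦ ?_
  · exact hdir.mono_comp _ (OrderHomClass.mono (Submodule.localized₀FrameHom S φ))
  · rw [← Submodule.localized₀_iSup, htop, Submodule.localized₀_top]
  · exact .of_linearEquiv (IsLocalizedModule.linearEquiv S ((P i).toLocalized₀ S φ)
      (LocalizedModule.mkLinearMap S (P i)))

end LocalizedModule

section GenericallyFlat

/-- An `A`-module `M` is generically flat at an ideal `p` if `M_a` is flat over `A` for some
`a ∉ p`. The ideal of interest is a minimal prime, that is, the generic point of a component of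
`Spec A`. -/
def GenericallyFlat {A : Type*} [CommRing A] (p : Ideal A) (M : Type*) [AddCommGroup M]
    [Module A M] : Prop :=
  ∃ a ∉ p, Module.Flat A (LocalizedModule (.powers a) M)

/-- All finite modules over the `A`-algebra `B` are generically flat over `A` at `p`. -/
def HasGenericFlatness.{w} {A : Type*} [CommRing A] (p : Ideal A) (B : Type*) [CommRing B]
    [Algebra A B] : Prop :=
  ∀ (M : Type w) [AddCommGroup M] [Module A M] [Module B M] [IsScalarTower A B M]
    [Module.Finite B M], GenericallyFlat p M

variable {A : Type*} [CommRing A] {p : Ideal A} [p.IsPrime]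

lemma exists_forall_flat_localizedModule_of_finite {ι : Type*} [Finite ι] {M : ι → Type*}
    [∀ i, AddCommGroup (M i)] [∀ i, Module A (M i)] (h : ∀ i, GenericallyFlat p (M i)) :
    ∃ a ∉ p, ∀ i, Module.Flat A (LocalizedModule (.powers a) (M i)) := by
  cases nonempty_fintype ι
  choose a hap hflat using h
  refine ⟨∏ i, a i, fun hprod ↦ ?_, fun i ↦ ?_⟩
  · obtain ⟨i, -, hi⟩ := Ideal.IsPrime.prod_mem_iff.mp hprod
    exact hap i hi
  · have := hflat i
    exact flat_localizedModule_powers_of_dvd (Finset.dvd_prod_of_mem a (Finset.mem_univ i))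

lemma genericallyFlat_of_finite [IsNoetherianRing A] (hp : IsField (Localization.AtPrime p))
    (M : Type*) [AddCommGroup M] [Module A M] [Module.Finite A M] : GenericallyFlat p M := by
  have : Module.FinitePresentation A M := Module.finitePresentation_of_finite A M
  have hfree : (⟨p, ‹_›⟩ : PrimeSpectrum A) ∈ Module.freeLocus A M := by
    rw [Module.mem_freeLocus]
    let := hp.toField
    exact Module.Free.of_divisionRing _ _
  obtain ⟨_, ⟨a, rfl⟩, hap, hsub⟩ :=
    PrimeSpectrum.isTopologicalBasis_basic_opens.exists_subset_of_mem_open hfree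
      Module.isOpen_freeLocus
  have := Module.basicOpen_subset_freeLocus_iff.mp hsub
  exact ⟨a, hap, .trans A (Localization.Away a) _⟩

end GenericallyFlat

section Krylov

variable {B : Type*} [CommRing B] {M N : Type*} [AddCommGroup M] [Module B M]
  [AddCommGroup N] [Module B N]

/-- The Krylov submodule `ι(N) + χ(ι(N)) + ⋯ + χ^(k-1)(ι(N))` of an endomorphism `χ` of `M` and a
linear map `ι : N → M`. -/
def krylovSubmodule (χ : Module.End B M) (ι : N →ₗ[B] M) (k : ℕ) : Submodule B M :=
  ⨆ i < k, LinearMap.range ((χ ^ i) ∘ₗ ι)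

variable (χ : Module.End B M) (ι : N →ₗ[B] M)

lemma krylovSubmodule_zero : krylovSubmodule χ ι 0 = ⊥ := by
  simp [krylovSubmodule]

lemma krylovSubmodule_succ (k : ℕ) :
    krylovSubmodule χ ι (k + 1) = krylovSubmodule χ ι k ⊔ LinearMap.range ((χ ^ k) ∘ₗ ι) :=
  Nat.iSup_lt_succ _ k

lemma krylovSubmodule_mono : Monotone (krylovSubmodule χ ι) :=
  fun _ _ hkl ↦ biSup_mono fun _ hi ↦ hi.trans_le hkl

lemma iSup_krylovSubmodule :
    ⨆ k, krylovSubmodule χ ι k = ⨆ i, LinearMap.range ((χ ^ i) ∘ₗ ι) :=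
  biSup_lt_eq_iSup

lemma map_krylovSubmodule_le (k : ℕ) :
    (krylovSubmodule χ ι k).map χ ≤ krylovSubmodule χ ι (k + 1) := by
  simp only [krylovSubmodule, Submodule.map_iSup, iSup_le_iff, ← LinearMap.range_comp]
  intro i hi
  rw [← LinearMap.comp_assoc, ← Module.End.mul_eq_comp, ← pow_succ']
  exact le_biSup (fun i ↦ LinearMap.range ((χ ^ i) ∘ₗ ι)) (Nat.succ_lt_succ hi)

lemma monotone_comap_krylovSubmodule :
    Monotone fun k ↦ (krylovSubmodule χ ι k).comap ((χ ^ k) ∘ₗ ι) := by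
  refine monotone_nat_of_le_succ fun k n hn ↦ ?_
  have hχ : χ ((χ ^ k) (ι n)) ∈ krylovSubmodule χ ι (k + 1) :=
    map_krylovSubmodule_le χ ι k (Submodule.mem_map_of_mem hn)
  simpa [pow_succ'] using hχ

end Krylov

section Devissage

variable {A B : Type*} [CommRing A] [CommRing B] [Algebra A B] {M N : Type*}
  [AddCommGroup M] [Module A M] [Module B M] [IsScalarTower A B M]
  [AddCommGroup N] [Module A N] [Module B N] [IsScalarTower A B N]

lemma flat_localizedModule_sup_range (S : Submonoid A) (P : Submodule B M) (φ : N →ₗ[B] M)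
    [Module.Flat A (LocalizedModule S P)]
    [Module.Flat A (LocalizedModule S (N ⧸ P.comap φ))] :
    Module.Flat A (LocalizedModule S ↥(P ⊔ LinearMap.range φ)) := by
  let Q := P ⊔ LinearMap.range φ
  let P' : Submodule B Q := P.comap Q.subtype
  let ψ : N →ₗ[B] Q ⧸ P' :=
    P'.mkQ ∘ₗ φ.codRestrict Q fun n ↦ Submodule.mem_sup_right ⟨n, rfl⟩
  have hψ : Function.Surjective ψ := by
    intro z
    obtain ⟨⟨z, hz⟩, rfl⟩ := P'.mkQ_surjective z
    obtain ⟨y, hy, _, ⟨n, rfl⟩, rfl⟩ := Submodule.mem_sup.mp hz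
    refine ⟨n, (Submodule.Quotient.eq P').mpr ?_⟩
    simpa [P'] using hy
  have hker : LinearMap.ker ψ = P.comap φ := by
    ext n
    simp [ψ, P']
  let e : (Q ⧸ P') ≃ₗ[B] N ⧸ P.comap φ :=
    (ψ.quotKerEquivOfSurjective hψ).symm ≪≫ₗ Submodule.quotEquivOfEq _ _ hker
  have : Module.Flat A (LocalizedModule S (Q ⧸ P')) :=
    flat_localizedModule_of_linearEquiv S (e.restrictScalars A)
  have hexact : Function.Exact (Submodule.inclusion (le_sup_left : P ≤ Q)) P'.mkQ := fun z ↦ by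
    simp [P', Submodule.inclusion, Subtype.ext_iff]
  exact flat_localizedModule_of_exact S
    (f := (Submodule.inclusion (le_sup_left : P ≤ Q)).restrictScalars A)
    (g := P'.mkQ.restrictScalars A) (Submodule.inclusion_injective le_sup_left) hexact
    P'.mkQ_surjective

lemma flat_localizedModule_krylovSubmodule (S : Submonoid A) (χ : Module.End B M)
    (ι : N →ₗ[B] M) (hflat : ∀ k, Module.Flat A
      (LocalizedModule S (N ⧸ (krylovSubmodule χ ι k).comap ((χ ^ k) ∘ₗ ι)))) (k : ℕ) :
    Module.Flat A (LocalizedModule S (krylovSubmodule χ ι k)) := by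
  induction k with
  | zero =>
    rw [krylovSubmodule_zero]
    infer_instance
  | succ k ih =>
    have := hflat k
    rw [krylovSubmodule_succ]
    exact flat_localizedModule_sup_range S _ _

variable {p : Ideal A} [p.IsPrime]

lemma exists_forall_flat_localizedModule_quotient [IsNoetherian B N] (K : ℕ →o Submodule B N)
    (hK : ∀ k, GenericallyFlat p (N ⧸ K k)) :
    ∃ a ∉ p, ∀ k, Module.Flat A (LocalizedModule (.powers a) (N ⧸ K k)) := by
  obtain ⟨l, hl⟩ := WellFoundedGT.monotone_chain_condition K
  obtain ⟨a, hap, hflat⟩ :=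
    exists_forall_flat_localizedModule_of_finite fun k : Fin (l + 1) ↦ hK k
  refine ⟨a, hap, fun k ↦ ?_⟩
  obtain hkl | hlk := le_total k l
  · exact hflat ⟨k, Nat.lt_succ_of_le hkl⟩
  · rw [← hl k hlk]
    exact hflat (Fin.last l)

end Devissage

section HasGenericFlatness

universe w

variable {A B C : Type*} [CommRing A] [CommRing B] [Algebra A B] [CommRing C] [Algebra A C]
  {p : Ideal A} [p.IsPrime]

lemma HasGenericFlatness.genericallyFlat_of_iSup_range_eq_top [IsNoetherianRing B]
    (hB : HasGenericFlatness.{w} p B) {M : Type*} {N : Type w}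
    [AddCommGroup M] [Module A M] [Module B M] [IsScalarTower A B M]
    [AddCommGroup N] [Module A N] [Module B N] [IsScalarTower A B N] [Module.Finite B N]
    (χ : Module.End B M) (ι : N →ₗ[B] M) (htop : ⨆ i, LinearMap.range ((χ ^ i) ∘ₗ ι) = ⊤) :
    GenericallyFlat p M := by
  obtain ⟨a, hap, hquot⟩ := exists_forall_flat_localizedModule_quotient (p := p)
    ⟨_, monotone_comap_krylovSubmodule χ ι⟩ fun k ↦ hB _
  refine ⟨a, hap, flat_localizedModule_of_directed (.powers a)
    (P := fun k ↦ (krylovSubmodule χ ι k).restrictScalars A)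
    (krylovSubmodule_mono χ ι).directed_le ?_
    (flat_localizedModule_krylovSubmodule (.powers a) χ ι hquot)⟩
  rw [← Submodule.restrictScalars_iSup, iSup_krylovSubmodule, htop, Submodule.restrictScalars_top]

open Polynomial in
lemma span_range_X_pow (R : Type*) [CommSemiring R] :
    Submodule.span R (Set.range fun i ↦ (X : R[X]) ^ i) = ⊤ := by
  simpa [monomial_one_right_eq_X_pow] using (basisMonomials R).span_eq

open Polynomial in
lemma HasGenericFlatness.polynomial [IsNoetherianRing B] (hB : HasGenericFlatness.{w} p B) :
    HasGenericFlatness.{w} p B[X] := by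
  intro M _ _ _ _ _
  let : Module B M := Module.compHom M (C : B →+* B[X])
  have : IsScalarTower B B[X] M := .of_algebraMap_smul fun _ _ ↦ rfl
  have : IsScalarTower A B M := .to₁₂₄ A B B[X] M
  obtain ⟨s, hs⟩ := Module.Finite.fg_top (R := B[X]) (M := M)
  let N : Submodule B M := Submodule.span B s
  have : Module.Finite B N := Module.Finite.span_finset B s
  refine hB.genericallyFlat_of_iSup_range_eq_top (Algebra.lsmul B B M (X : B[X])) N.subtype ?_
  rw [eq_top_iff, ← Submodule.restrictScalars_top B B[X] M, ← hs,
    ← Submodule.span_smul_of_span_eq_top (span_range_X_pow B), Submodule.span_le]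
  rintro _ ⟨_, ⟨i, rfl⟩, x, hx, rfl⟩
  exact Submodule.mem_iSup_of_mem i ⟨⟨x, Submodule.subset_span hx⟩, by simp [← map_pow]⟩

omit [p.IsPrime] in
lemma HasGenericFlatness.of_algHom_finite (hB : HasGenericFlatness.{w} p B) {f : B →ₐ[A] C}
    (hf : f.Finite) : HasGenericFlatness.{w} p C := by
  intro M _ _ _ _ _
  let : Algebra B C := f.toAlgebra
  let : Module B M := Module.compHom M f.toRingHom
  have : IsScalarTower B C M := .of_algebraMap_smul fun _ _ ↦ rfl
  have : IsScalarTower A B M := .of_algebraMap_smul fun a m ↦ by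
    change f (algebraMap A B a) • m = a • m
    rw [f.commutes, algebraMap_smul]
  have : Module.Finite B C := hf
  have : Module.Finite B M := .trans C M
  exact hB M

variable [IsNoetherianRing A]

lemma hasGenericFlatness_of_finite (hp : IsField (Localization.AtPrime p)) [Module.Finite A B] :
    HasGenericFlatness.{w} p B := by
  intro M _ _ _ _ _
  have : Module.Finite A M := .trans B M
  exact genericallyFlat_of_finite hp M

lemma hasGenericFlatness_mvPolynomial (hp : IsField (Localization.AtPrime p)) (n : ℕ) :
    HasGenericFlatness.{w} p (MvPolynomial (Fin n) A) := by
  induction n with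
  | zero =>
    have : Module.Finite A (MvPolynomial (Fin 0) A) :=
      .equiv (MvPolynomial.isEmptyAlgEquiv A (Fin 0)).symm.toLinearEquiv
    exact hasGenericFlatness_of_finite hp
  | succ n ih =>
    exact ih.polynomial.of_algHom_finite
      (.of_surjective (MvPolynomial.finSuccEquiv A n).symm.toAlgHom
        (MvPolynomial.finSuccEquiv A n).symm.surjective)

lemma hasGenericFlatness_of_finiteType (hp : IsField (Localization.AtPrime p))
    [Algebra.FiniteType A B] : HasGenericFlatness.{w} p B := by
  obtain ⟨n, π, hπ⟩ := Algebra.FiniteType.iff_quotient_mvPolynomial''.mp ‹Algebra.FiniteType A B›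
  exact (hasGenericFlatness_mvPolynomial hp n).of_algHom_finite (.of_surjective π hπ)

end HasGenericFlatness

lemma isField_localization_atPrime_of_mem_minimalPrimes {A : Type*} [CommRing A]
    [_root_.IsReduced A] {p : Ideal A} [p.IsPrime] (hp : p ∈ minimalPrimes A) :
    IsField (Localization.AtPrime p) := by
  have : Ring.KrullDimLE 0 (Localization.AtPrime p) := .of_isLocalization p hp _
  have : _root_.IsReduced (Localization.AtPrime p) :=
    isReduced_localizationPreserves p.primeCompl _ inferInstance
  exact Ring.KrullDimLE.isField_of_isReduced

section Stalk

open Scheme.Modules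

variable {X Y : Scheme.{u}}

lemma exists_germ_eq_germ_eq (F : X.Modules) (x : X)
    (r : X.presheaf.stalk x) (m : ↑(TopCat.Presheaf.stalk F.presheaf x)) :
    ∃ (W : X.Opens) (hx : x ∈ W) (s : Γ(X, W)) (t : Γ(F, W)),
      X.presheaf.germ W x hx s = r ∧ TopCat.Presheaf.germ F.presheaf W x hx t = m := by
  obtain ⟨U₁, h₁, s, rfl⟩ := X.presheaf.exists_germ_eq r
  obtain ⟨U₂, h₂, t, rfl⟩ := TopCat.Presheaf.exists_germ_eq F.presheaf m
  exact ⟨U₁ ⊓ U₂, ⟨h₁, h₂⟩, X.presheaf.map (homOfLE inf_le_left).op s,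
    F.presheaf.map (homOfLE inf_le_right).op t, X.presheaf.germ_res_apply _ _ _ _,
    TopCat.Presheaf.germ_res_apply F.presheaf _ _ _ _⟩

/-- The linear equivalence between stalks induced by an isomorphism of sheaves of modules. -/
noncomputable def stalkLinearEquiv {F G : X.Modules} (e : F ≅ G) (x : X) :
    ↑(TopCat.Presheaf.stalk F.presheaf x) ≃ₗ[X.presheaf.stalk x]
      ↑(TopCat.Presheaf.stalk G.presheaf x) where
  __ := ((TopCat.Presheaf.stalkFunctor Ab.{u} x).mapIso
    ((toPresheaf X).mapIso e)).addCommGroupIsoToAddEquiv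
  map_smul' r m := by
    obtain ⟨W, hx, s, t, rfl, rfl⟩ := exists_germ_eq_germ_eq F x r m
    have map_germ (t : Γ(F, W)) :
        (TopCat.Presheaf.stalkFunctor Ab.{u} x).map e.hom.mapPresheaf
          (TopCat.Presheaf.germ F.presheaf W x hx t) =
        TopCat.Presheaf.germ G.presheaf W x hx (e.hom.app W t) :=
      TopCat.Presheaf.stalkFunctor_map_germ_apply ..
    rw [← germ_smul_stalk]
    refine (map_germ _).trans ?_
    rw [Hom.app_smul, germ_smul_stalk]
    exact congrArg (fun z : ↑(TopCat.Presheaf.stalk G.presheaf x) ↦ X.presheaf.germ W x hx s • z)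
      (map_germ t).symm

/-- The stalk at `x` of the restriction of `F` along an open immersion `g` is the stalk of `F` at
`g x`. It is only additive here because the two stalks are modules over different local rings;
see `restrictStalkAddEquiv_smul` for its semilinearity. -/
noncomputable def restrictStalkAddEquiv (F : Y.Modules) (g : X ⟶ Y) [IsOpenImmersion g] (x : X) :
    ↑(TopCat.Presheaf.stalk (F.restrict g).presheaf x) ≃+
      ↑(TopCat.Presheaf.stalk F.presheaf (g x)) :=
  ((restrictStalkNatIso g x).app F).addCommGroupIsoToAddEquiv

lemma restrictStalkAddEquiv_germ (F : Y.Modules) (g : X ⟶ Y) [IsOpenImmersion g] (x : X)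
    (W : X.Opens) (hx : x ∈ W) (t : Γ(F.restrict g, W)) :
    restrictStalkAddEquiv F g x (TopCat.Presheaf.germ (F.restrict g).presheaf W x hx t) =
      TopCat.Presheaf.germ F.presheaf (g ''ᵁ W) (g x) (by simpa using hx)
        ((F.restrictAppIso g W).hom t) :=
  congr($(germ_restrictStalkNatIso_hom_app g x F hx) t)

lemma stalkMap_germ_appIso_inv (g : X ⟶ Y) [IsOpenImmersion g] (x : X)
    (W : X.Opens) (hx : x ∈ W) (s : Γ(X, W)) :
    g.stalkMap x (Y.presheaf.germ (g ''ᵁ W) (g x) (by simpa using hx) ((g.appIso W).inv s)) =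
      X.presheaf.germ W x hx s := by
  rw [Scheme.Hom.germ_stalkMap_apply]
  refine Eq.trans ?_ (X.presheaf.germ_res_apply (eqToHom (g.preimage_image_eq W)) x
    (by simpa using hx) s)
  exact congr(X.presheaf.germ _ x _ ($(g.appIso_inv_app W) s))

lemma restrictStalkAddEquiv_smul (F : Y.Modules) (g : X ⟶ Y) [IsOpenImmersion g] (x : X)
    (r : Y.presheaf.stalk (g x)) (m : ↑(TopCat.Presheaf.stalk (F.restrict g).presheaf x)) :
    restrictStalkAddEquiv F g x (g.stalkMap x r • m) = r • restrictStalkAddEquiv F g x m := by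
  obtain ⟨W, hx, s, t, hs, rfl⟩ := exists_germ_eq_germ_eq (F.restrict g) x
    (g.stalkMap x r) m
  have hr : r = Y.presheaf.germ (g ''ᵁ W) (g x) (by simpa using hx) ((g.appIso W).inv s) := by
    apply (ConcreteCategory.bijective_of_isIso (g.stalkMap x)).injective
    rw [stalkMap_germ_appIso_inv g x W hx, hs]
  rw [← hs, ← germ_smul_stalk, restrictStalkAddEquiv_germ, restrictStalkAddEquiv_germ, hr,
    ← germ_smul_stalk]
  rfl

lemma germ_stalkMap_fromSpec {U : X.Opens} (hU : IsAffineOpen U) (y : Spec Γ(X, U))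
    (hy : hU.fromSpec y ∈ U) :
    X.presheaf.germ U (hU.fromSpec y) hy ≫ hU.fromSpec.stalkMap y =
      (Scheme.ΓSpecIso Γ(X, U)).inv ≫ (Spec Γ(X, U)).presheaf.germ ⊤ y trivial := by
  rw [Scheme.Hom.germ_stalkMap, hU.fromSpec_app_self, Category.assoc]
  exact congr(_ ≫ $((Spec Γ(X, U)).presheaf.germ_res _ y hy))

lemma exists_isLocalizedModule_stalk_fromSpec {U : X.Opens} (hU : IsAffineOpen U) {F : X.Modules}
    {M : ModuleCat.{u} Γ(X, U)} (e : F.restrict hU.fromSpec ≅ tilde M) (y : Spec Γ(X, U))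
    (hy : hU.fromSpec y ∈ U) :
    letI : Module Γ(X, U) ↑(TopCat.Presheaf.stalk F.presheaf (hU.fromSpec y)) :=
      Module.compHom _ (X.presheaf.germ U (hU.fromSpec y) hy).hom
    ∃ φ : M →ₗ[Γ(X, U)] ↑(TopCat.Presheaf.stalk F.presheaf (hU.fromSpec y)),
      IsLocalizedModule (@Ideal.primeCompl _ _ (PrimeSpectrum.asIdeal y) y.isPrime) φ := by
  let : Module Γ(X, U) ↑(TopCat.Presheaf.stalk F.presheaf (hU.fromSpec y)) :=
    Module.compHom _ (X.presheaf.germ U (hU.fromSpec y) hy).hom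
  let ρ := (Scheme.ΓSpecIso Γ(X, U)).inv ≫ (Spec Γ(X, U)).presheaf.germ ⊤ y trivial
  have hρ : _ = ρ := germ_stalkMap_fromSpec hU y hy
  let : Module Γ(X, U) ↑(TopCat.Presheaf.stalk (tilde M).presheaf y) := Module.compHom _ ρ.hom
  let ε : ↑(TopCat.Presheaf.stalk (tilde M).presheaf y) ≃ₗ[Γ(X, U)]
      ↑(TopCat.Presheaf.stalk F.presheaf (hU.fromSpec y)) :=
    { __ := (stalkLinearEquiv e y).symm.toAddEquiv.trans (restrictStalkAddEquiv F hU.fromSpec y)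
      map_smul' c m := by
        change restrictStalkAddEquiv F hU.fromSpec y ((stalkLinearEquiv e y).symm (ρ c • m)) =
          X.presheaf.germ U (hU.fromSpec y) hy c • restrictStalkAddEquiv F hU.fromSpec y
            ((stalkLinearEquiv e y).symm m)
        rw [_root_.map_smul, ← restrictStalkAddEquiv_smul, ← hρ]
        rfl }
  let φ : M →ₗ[Γ(X, U)] ↑(TopCat.Presheaf.stalk (tilde M).presheaf y) := (tilde.toStalk M y).hom
  have : IsLocalizedModule (@Ideal.primeCompl _ _ (PrimeSpectrum.asIdeal y) y.isPrime) φ :=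
    tilde.instIsLocalizedModuleCarrierCarrierOfCarrierStalkAbPresheafPrimeComplAsIdealHomToStalk
      M y
  exact ⟨ε.toLinearMap ∘ₗ φ, .of_linearEquiv _ _ ε⟩

lemma exists_isLocalizedModule_stalk {U : X.Opens} (hU : IsAffineOpen U) {F : X.Modules}
    {M : ModuleCat.{u} Γ(X, U)} (e : F.restrict hU.fromSpec ≅ tilde M) {x : X} (hx : x ∈ U) :
    letI : Module Γ(X, U) ↑(TopCat.Presheaf.stalk F.presheaf x) :=
      Module.compHom _ (X.presheaf.germ U x hx).hom
    ∃ φ : M →ₗ[Γ(X, U)] ↑(TopCat.Presheaf.stalk F.presheaf x),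
      IsLocalizedModule (hU.primeIdealOf ⟨x, hx⟩).asIdeal.primeCompl φ := by
  obtain ⟨y, hy⟩ : ∃ y : Spec Γ(X, U), y = hU.primeIdealOf ⟨x, hx⟩ := ⟨_, rfl⟩
  obtain rfl : hU.fromSpec y = x := hy ▸ hU.fromSpec_primeIdealOf ⟨x, hx⟩
  rw [← hy]
  exact exists_isLocalizedModule_stalk_fromSpec hU e y hx

end Stalk

section FlatLocus

open Scheme.Modules

variable {X Y : Scheme.{u}} {f : X ⟶ Y} {F : X.Modules}

lemma isFlatAt_restrict {X' Y' : Scheme.{u}} (g : X' ⟶ X) (h : Y' ⟶ Y) (f' : X' ⟶ Y')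
    [IsOpenImmersion g] [IsOpenImmersion h] (comm : g ≫ f = f' ≫ h) {x : X'}
    (hflat : IsFlatAt f F (g x)) : IsFlatAt f' (F.restrict g) x := by
  have hpt : f (g x) = h (f' x) := by
    rw [← Scheme.Hom.comp_apply, comm, Scheme.Hom.comp_apply]
  let σ : Y.presheaf.stalk (f (g x)) ⟶ Y'.presheaf.stalk (f' x) :=
    Y.presheaf.stalkSpecializes (specializes_of_eq hpt.symm) ≫ h.stalkMap (f' x)
  have hσ : f.stalkMap (g x) ≫ g.stalkMap x = σ ≫ f'.stalkMap x := by
    have hcongr := Scheme.Hom.stalkMap_congr_hom _ _ comm x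
    rw [Scheme.Hom.stalkMap_comp, Scheme.Hom.stalkMap_comp] at hcongr
    rw [hcongr, Category.assoc]
    rfl
  have hσ_surj : Function.Surjective σ.hom :=
    (ConcreteCategory.bijective_of_isIso (h.stalkMap (f' x))).surjective.comp
      (ConcreteCategory.bijective_of_isIso (Y.presheaf.stalkCongr (.of_eq hpt)).hom).surjective
  let : Module (Y.presheaf.stalk (f (g x))) ↑(TopCat.Presheaf.stalk F.presheaf (g x)) :=
    Module.compHom _ (f.stalkMap (g x)).hom
  let : Module (Y'.presheaf.stalk (f' x)) ↑(TopCat.Presheaf.stalk (F.restrict g).presheaf x) :=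
    Module.compHom _ (f'.stalkMap x).hom
  let ε : ↑(TopCat.Presheaf.stalk F.presheaf (g x)) →ₛₗ[σ.hom]
      ↑(TopCat.Presheaf.stalk (F.restrict g).presheaf x) :=
    { __ := (restrictStalkAddEquiv F g x).symm.toAddMonoidHom
      map_smul' r m := by
        have hr : f'.stalkMap x (σ r) = g.stalkMap x (f.stalkMap (g x) r) := congr($hσ.symm r)
        change (restrictStalkAddEquiv F g x).symm (f.stalkMap (g x) r • m) =
          f'.stalkMap x (σ r) • (restrictStalkAddEquiv F g x).symm m
        rw [AddEquiv.symm_apply_eq, hr, restrictStalkAddEquiv_smul, AddEquiv.apply_symm_apply] }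
  have : Module.Flat (Y.presheaf.stalk (f (g x))) ↑(TopCat.Presheaf.stalk F.presheaf (g x)) :=
    hflat
  exact flat_of_bijective_semilinearMap hσ_surj ε (restrictStalkAddEquiv F g x).symm.bijective

lemma isFlatOver_restrict {U : Y.Opens} (hU : ∀ x, f x ∈ U → IsFlatAt f F x) :
    IsFlatOver (f ∣_ U) (F.restrict (f ⁻¹ᵁ U).ι) :=
  fun x ↦ isFlatAt_restrict _ U.ι _ (morphismRestrict_ι f U).symm (hU _ x.2)

lemma isFlatAt_of_isAffineOpen {W : Y.Opens} (hW : IsAffineOpen W) {x : X} (hx : f x ∈ W)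
    (hflat : letI : Module Γ(Y, W) ↑(TopCat.Presheaf.stalk F.presheaf x) :=
        Module.compHom _ (Y.presheaf.germ W (f x) hx ≫ f.stalkMap x).hom
      Module.Flat Γ(Y, W) ↑(TopCat.Presheaf.stalk F.presheaf x)) :
    IsFlatAt f F x := by
  let E := ↑(TopCat.Presheaf.stalk F.presheaf x)
  let := Y.presheaf.algebra_section_stalk ⟨f x, hx⟩
  have := hW.isLocalization_stalk ⟨f x, hx⟩
  let : Module Γ(Y, W) E := Module.compHom _ (Y.presheaf.germ W (f x) hx ≫ f.stalkMap x).hom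
  let : Module (Y.presheaf.stalk (f x)) E := Module.compHom _ (f.stalkMap x).hom
  have : IsScalarTower Γ(Y, W) (Y.presheaf.stalk (f x)) E := .of_algebraMap_smul fun _ _ ↦ rfl
  exact (Module.flat_iff_of_isLocalization (Y.presheaf.stalk (f x))
    (hW.primeIdealOf ⟨f x, hx⟩).asIdeal.primeCompl E).mpr hflat

lemma isFlatAt_of_flat_localizedModule_tensorProduct {W : Y.Opens} (hW : IsAffineOpen W)
    {U V : X.Opens} (hU : IsAffineOpen U) (hV : IsAffineOpen V) (hVU : V ≤ U) (hVW : V ≤ f ⁻¹ᵁ W)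
    {M : ModuleCat.{u} Γ(X, U)} (e : F.restrict hU.fromSpec ≅ tilde M) {a : Γ(Y, W)}
    (hflat : letI := (f.appLE W V hVW).hom.toAlgebra
      letI := (X.presheaf.map (homOfLE hVU).op).hom.toAlgebra
      Module.Flat Γ(Y, W)
        (LocalizedModule (.powers a) (TensorProduct Γ(X, U) Γ(X, V) M)))
    {x : X} (hx : x ∈ V) (hxa : f x ∈ Y.basicOpen a) : IsFlatAt f F x := by
  refine isFlatAt_of_isAffineOpen hW (hVW hx) ?_
  let : Algebra Γ(Y, W) Γ(X, V) := (f.appLE W V hVW).hom.toAlgebra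
  let : Algebra Γ(X, U) Γ(X, V) := (X.presheaf.map (homOfLE hVU).op).hom.toAlgebra
  let := X.presheaf.algebra_section_stalk ⟨x, hVU hx⟩
  let := X.presheaf.algebra_section_stalk ⟨x, hx⟩
  let : Algebra Γ(Y, W) (X.presheaf.stalk x) :=
    (Y.presheaf.germ W (f x) (hVW hx) ≫ f.stalkMap x).hom.toAlgebra
  have := hU.isLocalization_stalk ⟨x, hVU hx⟩
  have := hV.isLocalization_stalk ⟨x, hx⟩
  have : IsScalarTower Γ(X, U) Γ(X, V) (X.presheaf.stalk x) := .of_algebraMap_eq fun c ↦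
    (X.presheaf.germ_res_apply (homOfLE hVU) x hx c).symm
  have : IsScalarTower Γ(Y, W) Γ(X, V) (X.presheaf.stalk x) := .of_algebraMap_eq fun c ↦
    (f.germ_stalkMap_apply W x (hVW hx) c).trans
      (X.presheaf.germ_res_apply (homOfLE hVW) x hx (f.app W c)).symm
  let E := ↑(TopCat.Presheaf.stalk F.presheaf x)
  let : Module Γ(X, U) E := Module.compHom _ (X.presheaf.germ U x (hVU hx)).hom
  let : Module Γ(X, V) E := Module.compHom _ (X.presheaf.germ V x hx).hom
  let : Module Γ(Y, W) E :=
    Module.compHom _ (Y.presheaf.germ W (f x) (hVW hx) ≫ f.stalkMap x).hom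
  have : IsScalarTower Γ(X, U) (X.presheaf.stalk x) E := .of_algebraMap_smul fun _ _ ↦ rfl
  have : IsScalarTower Γ(X, V) (X.presheaf.stalk x) E := .of_algebraMap_smul fun _ _ ↦ rfl
  have : IsScalarTower Γ(Y, W) (X.presheaf.stalk x) E := .of_algebraMap_smul fun _ _ ↦ rfl
  have ha : IsUnit (algebraMap Γ(Y, W) (X.presheaf.stalk x) a) :=
    (((Y.mem_basicOpen a (f x) (hVW hx)).mp hxa).map (f.stalkMap x).hom :)
  obtain ⟨φ, hφ⟩ := exists_isLocalizedModule_stalk hU e (hVU hx)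
  exact flat_of_isLocalizedModule_of_isBaseChange (L := X.presheaf.stalk x)
    (hU.primeIdealOf ⟨x, hVU hx⟩).asIdeal.primeCompl (hV.primeIdealOf ⟨x, hx⟩).asIdeal.primeCompl
    φ (TensorProduct.isBaseChange Γ(X, U) M Γ(X, V)) ha

end FlatLocus

section Schemes

open Scheme.Modules

variable {X Y : Scheme.{u}} (f : X ⟶ Y) [LocallyOfFiniteType f] {F : X.Modules}

section AffineBase

variable {W : Y.Opens} (hW : IsAffineOpen W) [IsNoetherianRing Γ(Y, W)] {p : Ideal Γ(Y, W)}
  [p.IsPrime] (hp : IsField (Localization.AtPrime p))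

include hW hp

lemma exists_mem_nhds_forall_isFlatAt (hF : F.IsCoherent) {x : X} (hx : f x ∈ W) :
    ∃ s ∈ nhds x, ∃ a ∉ p, ∀ z ∈ s, f z ∈ Y.basicOpen a → IsFlatAt f F z := by
  obtain ⟨U, hU, hxU, M, hM, ⟨e⟩⟩ := hF x
  obtain ⟨V, hV, hxV, hVUW⟩ :=
    exists_isAffineOpen_mem_and_subset (show x ∈ U ⊓ f ⁻¹ᵁ W from ⟨hxU, hx⟩)
  have hVU : V ≤ U := hVUW.trans inf_le_left
  have hVW : V ≤ f ⁻¹ᵁ W := hVUW.trans inf_le_right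
  let : Algebra Γ(Y, W) Γ(X, V) := (f.appLE W V hVW).hom.toAlgebra
  let : Algebra Γ(X, U) Γ(X, V) := (X.presheaf.map (homOfLE hVU).op).hom.toAlgebra
  have : Algebra.FiniteType Γ(Y, W) Γ(X, V) := f.finiteType_appLE hW hV hVW
  obtain ⟨a, hap, hflat⟩ := hasGenericFlatness_of_finiteType hp (B := Γ(X, V))
    (TensorProduct Γ(X, U) Γ(X, V) M)
  exact ⟨V, V.2.mem_nhds hxV, a, hap, fun z hz hza ↦
    isFlatAt_of_flat_localizedModule_tensorProduct hW hU hV hVU hVW e hflat hz hza⟩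

lemma exists_notMem_forall_isFlatAt [QuasiCompact f] (hF : F.IsCoherent) :
    ∃ a ∉ p, ∀ x, f x ∈ Y.basicOpen a → IsFlatAt f F x := by
  obtain ⟨a, hap, ha⟩ : ∃ a ∉ p, ∀ x ∈ f ⁻¹ᵁ W, f x ∈ Y.basicOpen a → IsFlatAt f F x := by
    refine (f.isCompact_preimage hW.isCompact).induction_on
      (p := fun s ↦ ∃ a ∉ p, ∀ x ∈ s, f x ∈ Y.basicOpen a → IsFlatAt f F x)
      ⟨1, p.one_notMem, by simp⟩ ?_ ?_ fun x hx ↦ ?_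
    · rintro s t hst ⟨a, hap, ha⟩
      exact ⟨a, hap, fun x hx ↦ ha x (hst hx)⟩
    · rintro s t ⟨a, hap, ha⟩ ⟨b, hbp, hb⟩
      refine ⟨a * b, ‹p.IsPrime›.mul_notMem hap hbp, fun x hx hxab ↦ ?_⟩
      rw [Scheme.basicOpen_mul] at hxab
      exact hx.elim (fun h ↦ ha x h hxab.1) (fun h ↦ hb x h hxab.2)
    · obtain ⟨s, hs, hflat⟩ := exists_mem_nhds_forall_isFlatAt f hW hp hF hx
      exact ⟨s, mem_nhdsWithin_of_mem_nhds hs, hflat⟩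
  exact ⟨a, hap, fun x hx ↦ ha x (Y.basicOpen_le a hx) hx⟩

end AffineBase

lemma exists_nonempty_le_forall_isFlatAt [IsLocallyNoetherian Y] [IsReduced Y] [QuasiCompact f]
    (hF : F.IsCoherent) {O : Y.Opens} (hO : (O : Set Y).Nonempty) :
    ∃ U ≤ O, (U : Set Y).Nonempty ∧ ∀ x, f x ∈ U → IsFlatAt f F x := by
  obtain ⟨y, hy⟩ := hO
  obtain ⟨W, hW, hyW, hWO⟩ := exists_isAffineOpen_mem_and_subset hy
  have : IsNoetherianRing Γ(Y, W) := IsLocallyNoetherian.component_noetherian ⟨W, hW⟩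
  have : Nonempty W := ⟨⟨y, hyW⟩⟩
  obtain ⟨p, hp⟩ := Ideal.nonempty_minimalPrimes (I := (⊥ : Ideal Γ(Y, W))) bot_ne_top
  have : p.IsPrime := hp.1.1
  obtain ⟨a, hap, hflat⟩ := exists_notMem_forall_isFlatAt f hW
    (isField_localization_atPrime_of_mem_minimalPrimes hp) hF
  refine ⟨Y.basicOpen a, (Y.basicOpen_le a).trans hWO, ?_, hflat⟩
  by_contra hempty
  have ha : a = 0 :=
    (basicOpen_eq_bot_iff a).mp (Opens.ext (Set.not_nonempty_iff_eq_empty.mp hempty))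
  exact hap (ha ▸ p.zero_mem)

end Schemes

end GenericFlatness

theorem mainTheorem9_general {X Y : Scheme.{u}} (f : X ⟶ Y) [IsLocallyNoetherian Y]
    [IsReduced Y] [LocallyOfFiniteType f] [QuasiCompact f] (F : X.Modules) (hF : F.IsCoherent) :
    ∃ U : Y.Opens, Dense (U : Set Y) ∧
      Scheme.Modules.IsFlatOver (f ∣_ U) (F.restrict (f ⁻¹ᵁ U).ι) := by
  let 𝒰 : Set Y.Opens := {V | ∀ x, f x ∈ V → F.IsFlatAt f x}
  refine ⟨sSup 𝒰, ?_, GenericFlatness.isFlatOver_restrict fun x hx ↦ ?_⟩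
  · refine dense_iff_inter_open.mpr fun O hO hne ↦ ?_
    obtain ⟨V, hVO, ⟨y, hy⟩, hV⟩ :=
      GenericFlatness.exists_nonempty_le_forall_isFlatAt f hF (O := ⟨O, hO⟩) hne
    exact ⟨y, hVO hy, Opens.mem_sSup.mpr ⟨V, hV, hy⟩⟩
  · obtain ⟨V, hV, hxV⟩ := Opens.mem_sSup.mp hx
    exact hV x hxV

theorem mainTheorem9 {X Y : Scheme.{u}} (f : X ⟶ Y) [IsNoetherian X] [IsNoetherian Y]
    [IsReduced Y] [Nonempty Y] [LocallyOfFiniteType f] [QuasiCompact f]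
    (F : X.Modules) (hF : F.IsCoherent) :
    ∃ U : Y.Opens, (U : Set Y).Nonempty ∧
      Scheme.Modules.IsFlatOver (f ∣_ U) (F.restrict (f ⁻¹ᵁ U).ι) := by
  obtain ⟨U, hU, hflat⟩ := mainTheorem9_general f F hF
  exact ⟨U, hU.nonempty, hflat⟩
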